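/- Let $k$ be a field, $n>1$ an integer whose image in $k$ is nonzero, and $D\in k(x)^*$ such that $Y^n-D\in k(x)[Y]$ is irreducible. Let $K=k(x)(y)$ with $y^n=D$. A place of a field over $k$ is given by a discrete valuation ring containing $k$ whose fraction field is the given field, and $\nu$ denotes its normalized valuation. Let $\mathfrak p$ be a place of $k(x)$ with valuation ring $\mathfrak o_{\mathfrak p}$, maximal ideal $\mathfrak m_{\mathfrak p}$ and residue field $\kappa(\mathfrak p)=\mathfrak o_{\mathfrak p}/\mathfrak m_{\mathfrak p}$, let $\mathcal O'_{\mathfrak p}$ be the integral closure of $\mathfrak o_{\mathfrak p}$ in $K$, and put $d=\gcd(n,\nu_{\mathfrak p}(D))$. For a place $\mathfrak P$ of $K$ above $\mathfrak p$, write $e(\mathfrak P|\mathfrak p)$ for the ramification index and $f(\mathfrak P|\mathfrak p)$ for the degree of the residue field extension; $\deg$ of a place is the degree of its residue field over $k$. There is $z\in K$ with $\mathcal O'_{\mathfrak p}=\mathfrak o_{\mathfrak p}[z]$ and $z^n\in k(x)$ if and only if $d\in\{1,n\}$. More precisely, let $\pi\in k(x)$ be any element with $\nu_{\mathfrak p}(\pi)=1$.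 Then: (a) Suppose $d=1$, and let $a,b\in\mathbb Z$ be such that $a\,\nu_{\mathfrak p}(D)+bn=1$. Then $z=y^a\pi^b$ satisfies $\mathcal O'_{\mathfrak p}=\mathfrak o_{\mathfrak p}[z]$, and the minimal polynomial of $z$ over $k(x)$ is $Z^n-D^a\pi^{nb}$. Moreover there is exactly one place $\mathfrak P$ of $K$ above $\mathfrak p$, and $e(\mathfrak P|\mathfrak p)=n$, $f(\mathfrak P|\mathfrak p)=1$, $\nu_{\mathfrak P}(z)=1$. (b) Suppose $d=n$, and let $b\in\mathbb Z$ be such that $nb=-\nu_{\mathfrak p}(D)$. Then $z=y\pi^b$ satisfies $\mathcal O'_{\mathfrak p}=\mathfrak o_{\mathfrak p}[z]$, and the minimal polynomial of $z$ over $k(x)$ is $Z^n-D\pi^{-\nu_{\mathfrak p}(D)}$. Moreover $e(\mathfrak P|\mathfrak p)=1$ and $\nu_{\mathfrak P}(z)=0$ for every place $\mathfrak P$ of $K$ above $\mathfrak p$. The element $D\pi^{bn}$ lies in $\mathfrak o_{\mathfrak p}$, its residue class $\alpha=D\pi^{bn}+\mathfrak m_{\mathfrak p}\in\kappa(\mathfrak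 p)$ is nonzero, and there is a bijection $\mathfrak P\mapsto g_{\mathfrak P}$ from the set of places of $K$ above $\mathfrak p$ onto the set of monic irreducible factors of $Z^n-\alpha$ in $\kappa(\mathfrak p)[Z]$ such that, for every $\mathfrak P$, the residue class of $z$ at $\mathfrak P$ is a root of $g_{\mathfrak P}$, $f(\mathfrak P|\mathfrak p)=\deg g_{\mathfrak P}$, and $\deg\mathfrak P=\deg\mathfrak p\cdot\deg g_{\mathfrak P}$. (c) If $1<d<n$, then $e(\mathfrak P|\mathfrak p)=n/d$ for every place $\mathfrak P$ of $K$ above $\mathfrak p$. In all cases, $\bigl(\pi^{-\lfloor i\,\nu_{\mathfrak p}(D)/n\rfloor}\,y^i\bigr)_{i=0,\dots,n-1}$ is an $\mathfrak o_{\mathfrak p}$-basis of $\mathcal O'_{\mathfrak p}$. -/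

import Mathlib

noncomputable section

/-- A place of a field `F` over a constant field `k`: a discrete valuation ring that contains `k`
and has `F` as its field of fractions (every valuation subring of `F` has fraction field `F`). -/
structure FFPlace (k F : Type*) [Field k] [Field F] [Algebra k F] where
  /-- the valuation ring of the place -/
  ring : ValuationSubring F
  algebraMap_mem : ∀ c : k, algebraMap k F c ∈ ring
  isDVR : IsDiscreteValuationRing ring

namespace FFPlace

section Basic

variable {k F : Type*} [Field k] [Field F] [Algebra k F]

instance (P : FFPlace k F) : IsDiscreteValuationRing P.ring := P.isDVR

/-- The residue field of a place. -/
abbrev residueField (P : FFPlace k F) : Type _ := IsLocalRing.ResidueField P.ring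

/-- The valuation ring of a place over `k` is a `k`-algebra. -/
instance (P : FFPlace k F) : Algebra k P.ring :=
  ((algebraMap k F).codRestrict P.ring.toSubring P.algebraMap_mem).toAlgebra

/-- The degree of a place: the degree of its residue field over `k`. -/
def degree (P : FFPlace k F) : ℕ := Module.finrank k P.residueField

/-- The normalized valuation `ν_P : F → ℤ` of a place on the nonzero elements of `F`
(at `0`, where the valuation is `∞`, this function has the junk value `0`). -/
def ord (P : FFPlace k F) (t : F) : ℤ :=
  -WithZero.log ((IsDiscreteValuationRing.maximalIdeal P.ring).valuation F t)

theorem ord_mul (P : FFPlace k F) {s t : F} (hs : s ≠ 0) (ht : t ≠ 0) :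
    P.ord (s * t) = P.ord s + P.ord t := by
  unfold ord
  rw [map_mul, WithZero.log_mul (by simpa using hs) (by simpa using ht)]
  ring

theorem ord_inv (P : FFPlace k F) (t : F) : P.ord t⁻¹ = -P.ord t := by
  simp [ord]

theorem ord_zpow (P : FFPlace k F) (t : F) (m : ℤ) : P.ord (t ^ m) = m * P.ord t := by
  simp [ord]

theorem mem_ring_iff (P : FFPlace k F) {t : F} (ht : t ≠ 0) : t ∈ P.ring ↔ 0 ≤ P.ord t := by
  have h0 : (IsDiscreteValuationRing.maximalIdeal P.ring).valuation F t ≠ 0 := by simpa using ht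
  have key : 0 ≤ P.ord t ↔
      (IsDiscreteValuationRing.maximalIdeal P.ring).valuation F t ≤ 1 := by
    unfold ord
    rw [neg_nonneg, ← WithZero.log_one, WithZero.log_le_log h0 one_ne_zero]
  rw [key]
  constructor
  · intro h
    exact IsDedekindDomain.HeightOneSpectrum.valuation_le_one _ (⟨t, h⟩ : P.ring)
  · intro h
    obtain ⟨b, rfl⟩ := IsDiscreteValuationRing.exists_lift_of_le_one h
    exact b.2

/-- The normalized valuation is surjective: there are elements of valuation `1`. -/
theorem exists_ord_eq_one (P : FFPlace k F) : ∃ t : F, P.ord t = 1 := by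
  obtain ⟨t, ht⟩ := (IsDiscreteValuationRing.maximalIdeal P.ring).valuation_exists_uniformizer F
  exact ⟨t, by simp [ord, ht]⟩

end Basic

section Over

variable {k F : Type*} [Field k] [Field F] [Algebra k F]

/-- The places `P` of `K` that lie above the place `p` of the subfield `F`, i.e. whose valuation
ring meets `F` in the valuation ring of `p`. -/
structure Over (p : FFPlace k F) (K : Type*) [Field K] [Algebra k K] [Algebra F K] where
  /-- the place of the larger field -/
  place : FFPlace k K
  comap_ring : place.ring.comap (algebraMap F K) = p.ring

namespace Over

variable {K : Type*} [Field K] [Algebra k K] [Algebra F K] {p : FFPlace k F}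

theorem algebraMap_mem_iff (P : p.Over K) (t : F) :
    algebraMap F K t ∈ P.place.ring ↔ t ∈ p.ring := by
  have h := congrArg (fun A : ValuationSubring F => t ∈ A) P.comap_ring
  exact Iff.of_eq h

/-- The inclusion of the valuation ring of `p` into that of a place above `p`. -/
instance (P : p.Over K) : Algebra p.ring P.place.ring :=
  (((algebraMap F K).comp p.ring.subtype).codRestrict P.place.ring.toSubring
    (fun t => (P.algebraMap_mem_iff t).2 t.2)).toAlgebra

theorem coe_algebraMap (P : p.Over K) (t : p.ring) :
    ((algebraMap p.ring P.place.ring t : P.place.ring) : K) = algebraMap F K t := rfl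

instance (P : p.Over K) : IsLocalHom (algebraMap p.ring P.place.ring) where
  map_nonunit a ha := by
    obtain ⟨b, hb⟩ := ha.exists_right_inv
    have h1 : algebraMap F K a * (b : K) = 1 := by
      have := congrArg (fun c : P.place.ring => (c : K)) hb
      exact this
    have h2 : algebraMap F K ((a : F)⁻¹) ∈ P.place.ring := by
      rw [map_inv₀, ← eq_inv_of_mul_eq_one_right h1]
      exact b.2
    have ha0 : (a : F) ≠ 0 := by
      intro h
      rw [h] at h1
      simp at h1
    exact IsUnit.of_mul_eq_one ⟨(a : F)⁻¹, (P.algebraMap_mem_iff _).1 h2⟩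
      (Subtype.ext (mul_inv_cancel₀ ha0))

/-- The ramification index `e(P | p)`: the common value of the quotients `ν_P(t) / ν_p(t)` for
`t` in the small field with `ν_p(t) ≠ 0`, computed at some `t` with `ν_p(t) = 1`
(`FFPlace.Over.ord_algebraMap` shows that the choice of `t` does not matter). -/
def ramificationIdx (P : p.Over K) : ℕ :=
  (P.place.ord (algebraMap F K p.exists_ord_eq_one.choose)).toNat

theorem ord_algebraMap (P : p.Over K) (t : F) :
    P.place.ord (algebraMap F K t) = P.ramificationIdx * p.ord t := by
  have hs := p.exists_ord_eq_one.choose_spec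
  unfold ramificationIdx
  generalize p.exists_ord_eq_one.choose = s at hs ⊢
  rcases eq_or_ne t 0 with rfl | ht
  · simp [ord]
  have hs0 : s ≠ 0 := by
    rintro rfl
    simp [ord] at hs
  have hinj : ∀ r : F, r ≠ 0 → algebraMap F K r ≠ 0 := fun r hr => by simpa using hr
  have hnn : ∀ r : F, r ≠ 0 → (0 ≤ P.place.ord (algebraMap F K r) ↔ 0 ≤ p.ord r) := by
    intro r hr
    rw [← P.place.mem_ring_iff (hinj r hr), ← p.mem_ring_iff hr, P.algebraMap_mem_iff]
  have hzero : ∀ r : F, r ≠ 0 → p.ord r = 0 → P.place.ord (algebraMap F K r) = 0 := by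
    intro r hr h
    have h1 := (hnn r hr).2 h.ge
    have h2 : 0 ≤ P.place.ord (algebraMap F K r⁻¹) := by
      rw [hnn _ (inv_ne_zero hr), p.ord_inv, h, neg_zero]
    rw [map_inv₀, P.place.ord_inv] at h2
    omega
  have hs1 : 0 ≤ P.place.ord (algebraMap F K s) := (hnn s hs0).2 (by omega)
  rw [Int.toNat_of_nonneg hs1]
  have hu : p.ord (t * s ^ (-p.ord t)) = 0 := by
    rw [p.ord_mul ht (zpow_ne_zero _ hs0), p.ord_zpow, hs]
    ring
  have h3 := hzero _ (mul_ne_zero ht (zpow_ne_zero _ hs0)) hu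
  rw [map_mul, map_zpow₀, P.place.ord_mul (hinj t ht) (zpow_ne_zero _ (hinj s hs0)),
    P.place.ord_zpow] at h3
  linarith

/-- The inertia degree `f(P | p)`: the degree of the extension of residue fields. -/
def inertiaDeg (P : p.Over K) : ℕ := Module.finrank p.residueField P.place.residueField

end Over

end Over

end FFPlace

end

/-! ### Radical generators and averages over conjugates -/

open Polynomial

/-! Write t in `K` as ∑ c_i y^i with i < n. In an algebraic closure the conjugates of y are ζ^j y,
and Fourier inversion gives n c_i y^i = ∑_j ζ^(-ij) σ_j(t). Since n is a unit of the valuation ring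
𝔬 of `p`, the monomials of an integral element are integral, and those of an element in the radical
of an ideal generated from 𝔬 stay in such a radical (`exists_pow_monomial_eq`). As (c y^i)^n = c^n
D^i lies in the base, integrality of a monomial means n ν(c) + i ν(D) ≥ 0. This yields the local
basis, and shows that 𝔬[y] is the integral closure when ν(D) is 0 or 1.

For ramification (`ramificationIdx_eq`), n ν_P(y) = e ν(D) forces e = g · n/d. Some uniformizer at P
lies in the radical of the ideal generated by a uniformizer of `p`; each of its monomials then has
P-order a positive multiple of g, so g = 1.

If d is 1 or n, a monomial change of generator makes the radicand of order 1 or 0, and a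
Kummer–Dedekind argument for 𝔬[z] describes the places. Conversely, if 𝔬[z] is the integral closure
and z^n is in the base, the new radicand has order 0 or 1 (`ord_radicand_of_integralClosure_eq`).
Since n/d is a ramification index, d does not depend on the radical generator, so d is n or 1. -/

theorem finrank_eq_of_irreducible_X_pow_sub_C {F K : Type*} [Field F] [Field K] [Algebra F K]
    {n : ℕ} (hn : n ≠ 0) {D : F} (hirr : Irreducible (X ^ n - C D : F[X])) {y : K}
    (hy : y ^ n = algebraMap F K D) (hK : IntermediateField.adjoin F {y} = ⊤) :
    FiniteDimensional F K ∧ Module.finrank F K = n := by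
  have hmin : X ^ n - C D = minpoly F y :=
    minpoly.eq_of_irreducible_of_monic hirr (by simp [hy]) (monic_X_pow_sub_C D hn)
  have hint : IsIntegral F y := ⟨X ^ n - C D, monic_X_pow_sub_C D hn, by simp [hy]⟩
  have hfin : FiniteDimensional F (IntermediateField.adjoin F {y}) :=
    IntermediateField.adjoin.finiteDimensional hint
  have hrank := IntermediateField.adjoin.finrank hint
  rw [← hmin, natDegree_X_pow_sub_C] at hrank
  rw [hK] at hfin hrank
  exact ⟨Module.Finite.equiv IntermediateField.topEquiv.toLinearEquiv,
    (IntermediateField.finrank_top' (F := F) (E := K)) ▸ hrank⟩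

/-- `y` is a radical generator of `K` over `F`, with `n = [K : F]` and `y ^ n = D`. -/
structure IsRadicalGenerator {F K : Type*} [Field F] [Field K] [Algebra F K] (n : ℕ) (y : K)
    (D : F) : Prop where
  one_lt : 1 < n
  cast_ne_zero : (n : F) ≠ 0
  finiteDimensional : FiniteDimensional F K
  finrank_eq : Module.finrank F K = n
  pow_eq : y ^ n = algebraMap F K D
  adjoin_eq_top : IntermediateField.adjoin F {y} = ⊤

namespace IsRadicalGenerator

variable {F K : Type*} [Field F] [Field K] [Algebra F K] {n : ℕ} {y : K} {D : F}

theorem ne_zero_nat (h : IsRadicalGenerator n y D) : n ≠ 0 := by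
  have := h.one_lt
  omega

theorem ne_zero (h : IsRadicalGenerator n y D) : y ≠ 0 := by
  rintro rfl
  have h1 := h.adjoin_eq_top
  have h2 := h.finrank_eq
  rw [IntermediateField.adjoin_zero] at h1
  have h3 := IntermediateField.bot_eq_top_iff_finrank_eq_one.1 h1
  have := h.one_lt
  omega

theorem monomial_pow (h : IsRadicalGenerator n y D) (c : F) (i : ℕ) :
    (algebraMap F K c * y ^ i) ^ n = algebraMap F K (c ^ n * D ^ i) := by
  rw [mul_pow, ← pow_mul, mul_comm i n, pow_mul, h.pow_eq, map_mul, map_pow, map_pow]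

theorem radicand_ne_zero (h : IsRadicalGenerator n y D) : D ≠ 0 := by
  rintro rfl
  have := h.pow_eq
  rw [map_zero] at this
  exact h.ne_zero (pow_eq_zero_iff h.ne_zero_nat |>.1 this)

theorem minpoly_eq (h : IsRadicalGenerator n y D) : minpoly F y = X ^ n - C D := by
  have hfin := h.finiteDimensional
  have hint : IsIntegral F y := .of_finite F y
  have hrank := IntermediateField.adjoin.finrank hint
  rw [h.adjoin_eq_top, IntermediateField.finrank_top', h.finrank_eq] at hrank
  refine (Polynomial.eq_of_monic_of_dvd_of_natDegree_le (minpoly.monic hint)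
    (monic_X_pow_sub_C D h.ne_zero_nat) (minpoly.dvd F y ?_) ?_).symm
  · rw [map_sub, map_pow, aeval_X, aeval_C, h.pow_eq, sub_self]
  rw [natDegree_X_pow_sub_C, ← hrank]

/-- Separability is what makes the integral closure of a valuation ring in `K` a Dedekind domain
with fraction field `K` below. -/
theorem isSeparable (h : IsRadicalGenerator n y D) : Algebra.IsSeparable F K := by
  have hs : IsSeparable F y := by
    rw [IsSeparable, h.minpoly_eq]
    exact separable_X_pow_sub_C D h.cast_ne_zero h.radicand_ne_zero
  have := (IntermediateField.isSeparable_adjoin_simple_iff_isSeparable F K).2 hs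
  rw [h.adjoin_eq_top] at this
  exact Algebra.IsSeparable.of_algHom F _ (IntermediateField.topEquiv (F := F) (E := K)).symm.toAlgHom

theorem exists_polynomial (h : IsRadicalGenerator n y D) (t : K) :
    ∃ f : F[X], f.natDegree < n ∧ aeval y f = t := by
  have hfin := h.finiteDimensional
  have hint : IsIntegral F y := .of_finite F y
  have ht : t ∈ IntermediateField.adjoin F {y} := by simp [h.adjoin_eq_top]
  rw [← IntermediateField.mem_toSubalgebra,
    IntermediateField.adjoin_simple_toSubalgebra_of_isAlgebraic hint.isAlgebraic,
    Algebra.adjoin_singleton_eq_range_aeval] at ht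
  obtain ⟨f, rfl⟩ := ht
  refine ⟨f %ₘ minpoly F y, ?_, ?_⟩
  · have := natDegree_modByMonic_lt f (minpoly.monic hint) (minpoly.ne_one F y)
    rwa [h.minpoly_eq, natDegree_X_pow_sub_C, ← h.minpoly_eq] at this
  · change _ = aeval y f
    exact aeval_modByMonic_eq_self_of_root (minpoly.aeval F y)

theorem exists_algHom (h : IsRadicalGenerator n y D) {Ω : Type*} [Field Ω] [Algebra F Ω]
    [Algebra K Ω] [IsScalarTower F K Ω] {ζ : Ω} (hζ : ζ ^ n = 1) :
    ∃ σ : K →ₐ[F] Ω, σ y = ζ * algebraMap K Ω y := by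
  have hfin := h.finiteDimensional
  have hint : IsIntegral F y := .of_finite F y
  let pb := IntermediateField.adjoin.powerBasis hint
  have hgen : aeval (ζ * algebraMap K Ω y) (minpoly F pb.gen) = 0 := by
    rw [IntermediateField.adjoin.powerBasis_gen, IntermediateField.minpoly_gen, h.minpoly_eq]
    rw [map_sub, map_pow, aeval_X, aeval_C, mul_pow, hζ, one_mul, ← map_pow, h.pow_eq,
      ← IsScalarTower.algebraMap_apply, sub_self]
  let τ := pb.lift _ hgen
  have hτ : τ pb.gen = ζ * algebraMap K Ω y := pb.lift_gen _ hgen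
  refine ⟨τ.comp ((IntermediateField.equivOfEq h.adjoin_eq_top).symm.toAlgHom.comp
    IntermediateField.topEquiv.symm.toAlgHom), ?_⟩
  rw [← hτ]
  rfl

/-- The monomials of an element are averages of its conjugates. -/
theorem sum_conjugates (h : IsRadicalGenerator n y D) {Ω : Type*} [Field Ω] [Algebra F Ω]
    [Algebra K Ω] [IsScalarTower F K Ω] {ζ : Ω} (hζ : IsPrimitiveRoot ζ n)
    {σ : ℕ → K →ₐ[F] Ω} (hσ : ∀ j, σ j y = ζ ^ j * algebraMap K Ω y) {f : F[X]}
    (hf : f.natDegree < n) {i : ℕ} (hi : i < n) :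
    ∑ j ∈ Finset.range n, (ζ⁻¹) ^ (i * j) * σ j (aeval y f) =
      n * algebraMap K Ω (algebraMap F K (f.coeff i) * y ^ i) := by
  have h1 : ∀ j, σ j (aeval y f) = ∑ l ∈ Finset.range n,
      algebraMap K Ω (algebraMap F K (f.coeff l) * y ^ l) * ζ ^ (l * j) := by
    intro j
    rw [aeval_eq_sum_range' hf, map_sum]
    refine Finset.sum_congr rfl fun l _ => ?_
    rw [Algebra.smul_def, map_mul, map_mul, map_pow, hσ, AlgHom.commutes, map_pow,
      IsScalarTower.algebraMap_apply F K Ω]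
    ring
  simp_rw [h1, Finset.mul_sum]
  rw [Finset.sum_comm, Finset.sum_eq_single_of_mem i (Finset.mem_range.2 hi)]
  · have hz := hζ.ne_zero h.ne_zero_nat
    have : ∀ j ∈ Finset.range n, (ζ⁻¹) ^ (i * j) *
        (algebraMap K Ω (algebraMap F K (f.coeff i) * y ^ i) * ζ ^ (i * j)) =
        algebraMap K Ω (algebraMap F K (f.coeff i) * y ^ i) := by
      intro j _
      rw [inv_pow]
      field_simp
    rw [Finset.sum_congr rfl this]
    simp
  · intro l hl hli
    have hz := hζ.ne_zero h.ne_zero_nat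
    -- For l ≠ i the sum over j is geometric, with ratio a nontrivial n-th root of unity, so it
    -- vanishes.
    have hne : ζ ^ l * (ζ⁻¹) ^ i ≠ 1 := by
      intro he
      rw [inv_pow, mul_inv_eq_one₀ (pow_ne_zero _ hz)] at he
      exact hli (hζ.pow_inj (Finset.mem_range.1 hl) hi he)
    have hgeom : ∑ j ∈ Finset.range n, (ζ ^ l * (ζ⁻¹) ^ i) ^ j = 0 := by
      have := geom_sum_mul (ζ ^ l * (ζ⁻¹) ^ i) n
      rw [mul_pow, ← pow_mul, ← pow_mul, mul_comm l, mul_comm i, pow_mul, pow_mul, inv_pow ζ n,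
        hζ.pow_eq_one, inv_one, one_pow, one_pow, mul_one, sub_self] at this
      exact (mul_eq_zero.1 this).resolve_right (sub_ne_zero.2 hne)
    rw [← mul_zero (algebraMap K Ω (algebraMap F K (f.coeff l) * y ^ l)), ← hgeom,
      Finset.mul_sum]
    refine Finset.sum_congr rfl fun j _ => ?_
    rw [mul_pow, ← pow_mul, ← pow_mul]
    ring

/-- If an integral element lies in the radical of the ideal generated by `c`, then so do its
monomials; this is expressed through their `n`-th powers, which lie in the base. -/
theorem exists_pow_monomial_eq (h : IsRadicalGenerator n y D) {A : Type*} [CommRing A]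
    [Algebra A F] [Algebra A K] [IsScalarTower A F K] [IsIntegrallyClosed A]
    [IsFractionRing A F] (hnA : IsUnit (n : A)) {f : F[X]} (hf : f.natDegree < n)
    (hint : IsIntegral A (aeval y f)) (c : A) (hc : c ≠ 0) (N : ℕ) {s : K}
    (hs : IsIntegral A s) (hfs : aeval y f ^ N = algebraMap A K c * s) {i : ℕ} (hi : i < n) :
    ∃ (M : ℕ) (r : A), 0 < M ∧
      (f.coeff i ^ n * D ^ i) ^ M = algebraMap A F c ^ n * algebraMap A F r := by
  -- `K` need not contain the n-th roots of unity, so conjugates are taken in an algebraic closure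
  -- and integrality is tested there.
  let Ω := AlgebraicClosure K
  have hnK : (n : K) ≠ 0 := by
    rw [← map_natCast (algebraMap F K)]
    exact (_root_.map_ne_zero _).2 h.cast_ne_zero
  have : NeZero (n : K) := ⟨hnK⟩
  obtain ⟨ζ, hζ⟩ := HasEnoughRootsOfUnity.exists_primitiveRoot Ω n
  have hex : ∀ j : ℕ, ∃ σ : K →ₐ[F] Ω, σ y = ζ ^ j * algebraMap K Ω y := fun j =>
    h.exists_algHom (by rw [← pow_mul, mul_comm, pow_mul, hζ.pow_eq_one, one_pow])
  choose σ hσ using hex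
  let B := integralClosure A Ω
  have hσint : ∀ j x, IsIntegral A x → IsIntegral A (σ j x) := fun j x hx =>
    hx.map ((σ j).restrictScalars A)
  have hζint : IsIntegral A ζ⁻¹ :=
    ⟨X ^ n - 1, monic_X_pow_sub_C 1 h.ne_zero_nat, by simp [hζ.pow_eq_one]⟩
  let t : ℕ → B := fun j => ⟨σ j (aeval y f), hσint j _ hint⟩
  let s' : ℕ → B := fun j => ⟨σ j s, hσint j _ hs⟩
  let w : B := ⟨ζ⁻¹, hζint⟩
  let I : Ideal B := (Ideal.span {algebraMap A B c}).radical
  have ht : ∀ j, t j ∈ I := by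
    intro j
    refine ⟨N, Ideal.mem_span_singleton.2 ⟨s' j, Subtype.ext ?_⟩⟩
    change σ j (aeval y f) ^ N = algebraMap A Ω c * σ j s
    rw [← map_pow, hfs, map_mul, IsScalarTower.algebraMap_apply A F K, AlgHom.commutes,
      ← IsScalarTower.algebraMap_apply A F Ω]
  obtain ⟨m, hm⟩ := (hnA.map (algebraMap A B)).exists_left_inv
  have hmem : m * ∑ j ∈ Finset.range n, w ^ (i * j) * t j ∈ I :=
    I.mul_mem_left _ (I.sum_mem fun j _ => I.mul_mem_left _ (ht j))
  have hval : ((m * ∑ j ∈ Finset.range n, w ^ (i * j) * t j : B) : Ω) =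
      algebraMap K Ω (algebraMap F K (f.coeff i) * y ^ i) := by
    have h1 : ((∑ j ∈ Finset.range n, w ^ (i * j) * t j : B) : Ω) =
        ∑ j ∈ Finset.range n, (ζ⁻¹) ^ (i * j) * σ j (aeval y f) := by
      rw [AddSubmonoidClass.coe_finsetSum]
      rfl
    rw [MulMemClass.coe_mul, h1, h.sum_conjugates hζ hσ hf hi, ← mul_assoc]
    have h2 := congrArg (fun b : B => (b : Ω)) hm
    simp only [map_natCast] at h2
    have h3 : (m : Ω) * (n : Ω) = 1 := h2
    rw [h3, one_mul]
  -- The exponent provided by the radical may be 0; one more factor makes it positive.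
  obtain ⟨M, hM⟩ := hmem
  obtain ⟨b, hb⟩ := Ideal.mem_span_singleton.1 (Ideal.mul_mem_left _
    (m * ∑ j ∈ Finset.range n, w ^ (i * j) * t j) hM)
  rw [← pow_succ'] at hb
  have hb' : (algebraMap K Ω (algebraMap F K (f.coeff i) * y ^ i)) ^ (M + 1) =
      algebraMap A Ω c * (b : Ω) := by
    rw [← hval]
    exact congrArg (fun b : B => (b : Ω)) hb
  -- Taking n-th powers brings the monomial back into `F`, where integral closedness of `A` applies
  -- to the quotient by c^n.
  have hb2 : algebraMap F Ω ((f.coeff i ^ n * D ^ i) ^ (M + 1)) =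
      algebraMap F Ω (algebraMap A F c ^ n) * (b : Ω) ^ n := by
    have h4 : ((algebraMap K Ω (algebraMap F K (f.coeff i) * y ^ i)) ^ (M + 1)) ^ n =
        (algebraMap A Ω c) ^ n * (b : Ω) ^ n := by
      rw [hb', mul_pow]
    rw [map_pow (algebraMap F Ω) (algebraMap A F c), ← IsScalarTower.algebraMap_apply A F Ω, ← h4,
      ← pow_mul, mul_comm (M + 1) n, pow_mul, ← map_pow (algebraMap K Ω), h.monomial_pow,
      ← IsScalarTower.algebraMap_apply F K Ω, map_pow]
  have hcF : algebraMap A F c ≠ 0 := by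
    simpa using (IsFractionRing.injective A F).ne hc
  have hbF : algebraMap F Ω ((f.coeff i ^ n * D ^ i) ^ (M + 1) / algebraMap A F c ^ n) =
      (b : Ω) ^ n := by
    rw [map_div₀, hb2, mul_comm, mul_div_assoc, div_self, mul_one]
    exact (_root_.map_ne_zero _).2 (pow_ne_zero _ hcF)
  have hbint : IsIntegral A ((f.coeff i ^ n * D ^ i) ^ (M + 1) / algebraMap A F c ^ n) := by
    refine (isIntegral_algebraMap_iff (FaithfulSMul.algebraMap_injective F Ω)).1 ?_
    rw [hbF]
    exact b.2.pow n
  obtain ⟨r, hr⟩ := IsIntegrallyClosed.isIntegral_iff.1 hbint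
  refine ⟨M + 1, r, M.succ_pos, ?_⟩
  rw [hr]
  field_simp

end IsRadicalGenerator

/-! ### Orders at a place -/

namespace FFPlace

variable {k F : Type*} [Field k] [Field F] [Algebra k F]

theorem ord_zero (P : FFPlace k F) : P.ord 0 = 0 := by
  simp [ord]

theorem ord_one (P : FFPlace k F) : P.ord 1 = 0 := by
  simp [ord]

theorem ord_pow (P : FFPlace k F) (t : F) (m : ℕ) : P.ord (t ^ m) = m * P.ord t := by
  simp [ord]

theorem ord_ne_zero_imp (P : FFPlace k F) {t : F} (ht : P.ord t ≠ 0) : t ≠ 0 := by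
  rintro rfl
  exact ht P.ord_zero

/-- The ultrametric inequality, reduced to closure of the valuation ring under sums by scaling with
t^(-N). Zero terms and a zero sum are set apart because `ord` has the junk value 0 at 0. -/
theorem le_ord_sum (P : FFPlace k F) {ι : Type*} (s : Finset ι) (f : ι → F) (N : ℤ)
    (h : ∀ i ∈ s, f i = 0 ∨ N ≤ P.ord (f i)) (hs : ∑ i ∈ s, f i ≠ 0) :
    N ≤ P.ord (∑ i ∈ s, f i) := by
  obtain ⟨t, ht⟩ := P.exists_ord_eq_one
  have ht0 : t ≠ 0 := P.ord_ne_zero_imp (by omega)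
  have htN : t ^ (-N) ≠ 0 := zpow_ne_zero _ ht0
  have hmem : ∑ i ∈ s, f i * t ^ (-N) ∈ P.ring := by
    refine sum_mem fun i hi => ?_
    by_cases hfi : f i = 0
    · simp [hfi]
    · rw [P.mem_ring_iff (mul_ne_zero hfi htN), P.ord_mul hfi htN, P.ord_zpow, ht]
      have := (h i hi).resolve_left hfi
      omega
  rw [← Finset.sum_mul, P.mem_ring_iff (mul_ne_zero hs htN), P.ord_mul hs htN, P.ord_zpow,
    ht] at hmem
  omega

theorem ring_ne_top (P : FFPlace k F) : P.ring ≠ ⊤ := by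
  intro h
  obtain ⟨t, ht⟩ := P.exists_ord_eq_one
  have ht0 : t ≠ 0 := P.ord_ne_zero_imp (by omega)
  have := (P.mem_ring_iff (inv_ne_zero ht0)).1 (by rw [h]; trivial)
  rw [P.ord_inv] at this
  omega

theorem mem_maximalIdeal_iff (P : FFPlace k F) {t : P.ring} (ht : (t : F) ≠ 0) :
    t ∈ IsLocalRing.maximalIdeal P.ring ↔ 0 < P.ord (t : F) := by
  have h0 := (P.mem_ring_iff ht).1 t.2
  rw [IsLocalRing.mem_maximalIdeal, mem_nonunits_iff, not_iff_comm, not_lt]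
  constructor
  · intro h
    have hinv : (t : F)⁻¹ ∈ P.ring := by
      rw [P.mem_ring_iff (inv_ne_zero ht), P.ord_inv]
      omega
    exact IsUnit.of_mul_eq_one ⟨_, hinv⟩ (Subtype.ext (mul_inv_cancel₀ ht))
  · intro h
    obtain ⟨b, hb⟩ := h.exists_right_inv
    have hb' : (t : F) * b = 1 := congrArg Subtype.val hb
    have hb0 : (b : F) ≠ 0 := right_ne_zero_of_mul_eq_one hb'
    have h1 := (P.mem_ring_iff hb0).1 b.2
    have h2 := P.ord_mul ht hb0
    rw [hb', P.ord_one] at h2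
    omega

theorem ext_ring {P Q : FFPlace k F} (h : P.ring = Q.ring) : P = Q := by
  cases P; cases Q; cases h; rfl

variable {p : FFPlace k F}

theorem isUnit_natCast {n : ℕ} (hn : (n : k) ≠ 0) : IsUnit (n : p.ring) := by
  have := (isUnit_iff_ne_zero.2 hn).map (algebraMap k p.ring)
  simpa using this

end FFPlace

/-! ### Orders of coefficients and the local integral basis -/

namespace IsRadicalGenerator

variable {k F K : Type*} [Field k] [Field F] [Algebra k F] [Field K] [Algebra F K]
  {n : ℕ} {y : K} {D : F} (p : FFPlace k F)

theorem monomial_ord (h : IsRadicalGenerator n y D) {c : F} (hc : c ≠ 0) (i : ℕ) :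
    p.ord (c ^ n * D ^ i) = n * p.ord c + i * p.ord D := by
  rw [p.ord_mul (pow_ne_zero _ hc) (pow_ne_zero _ h.radicand_ne_zero), p.ord_pow, p.ord_pow]

theorem isIntegral_monomial (h : IsRadicalGenerator n y D) {c : F} {i : ℕ}
    (hc : 0 ≤ n * p.ord c + i * p.ord D) : IsIntegral p.ring (algebraMap F K c * y ^ i) := by
  by_cases hc0 : c = 0
  · rw [hc0, map_zero, zero_mul]
    exact isIntegral_zero
  refine IsIntegral.of_pow (Nat.pos_of_ne_zero h.ne_zero_nat) ?_
  rw [h.monomial_pow]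
  have hmem : c ^ n * D ^ i ∈ p.ring := by
    rw [p.mem_ring_iff (mul_ne_zero (pow_ne_zero _ hc0) (pow_ne_zero _ h.radicand_ne_zero)),
      h.monomial_ord p hc0]
    exact hc
  exact isIntegral_algebraMap (R := p.ring) (A := K) (x := ⟨_, hmem⟩)

/-- No control of M is needed: with c = 1 the inequality makes the order of the monomial's n-th
power nonnegative, with c a uniformizer it makes it positive. -/
theorem exists_le_ord_coeff (h : IsRadicalGenerator n y D) (hn : (n : k) ≠ 0) {f : F[X]}
    (hf : f.natDegree < n) (hint : IsIntegral p.ring (aeval y f)) (c : p.ring) (hc : c ≠ 0)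
    (N : ℕ) {s : K} (hs : IsIntegral p.ring s)
    (hfs : aeval y f ^ N = algebraMap p.ring K c * s) (i : ℕ) (hi : f.coeff i ≠ 0) :
    ∃ M : ℕ, 0 < M ∧ n * p.ord (c : F) ≤ M * (n * p.ord (f.coeff i) + i * p.ord D) := by
  have hin : i < n := (le_natDegree_of_ne_zero hi).trans_lt hf
  obtain ⟨M, r, hM, hr⟩ := h.exists_pow_monomial_eq (FFPlace.isUnit_natCast hn) hf hint c hc N
    hs hfs hin
  refine ⟨M, hM, ?_⟩
  have hc' : (c : F) ≠ 0 := by simpa using hc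
  have hL : (f.coeff i ^ n * D ^ i) ^ M ≠ 0 :=
    pow_ne_zero _ (mul_ne_zero (pow_ne_zero _ hi) (pow_ne_zero _ h.radicand_ne_zero))
  have hr0 : (r : F) ≠ 0 := by
    rw [hr] at hL
    exact right_ne_zero_of_mul hL
  have h1 := congrArg p.ord hr
  rw [p.ord_pow, h.monomial_ord p hi] at h1
  have h2 : p.ord (algebraMap p.ring F c ^ n * algebraMap p.ring F r) =
      n * p.ord (c : F) + p.ord (r : F) := by
    rw [← p.ord_pow, ← p.ord_mul (pow_ne_zero _ hc') hr0]
    rfl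
  have h3 := (p.mem_ring_iff hr0).1 r.2
  rw [h1, h2]
  omega

theorem nonneg_ord_coeff (h : IsRadicalGenerator n y D) (hn : (n : k) ≠ 0) {f : F[X]}
    (hf : f.natDegree < n) (hint : IsIntegral p.ring (aeval y f)) (i : ℕ)
    (hi : f.coeff i ≠ 0) : 0 ≤ n * p.ord (f.coeff i) + i * p.ord D := by
  obtain ⟨M, hM, hle⟩ := h.exists_le_ord_coeff p hn hf hint 1 one_ne_zero 1 hint
    (by rw [map_one, one_mul, pow_one]) i hi
  rw [OneMemClass.coe_one, p.ord_one, mul_zero] at hle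
  exact nonneg_of_mul_nonneg_right hle (by exact_mod_cast hM)

theorem integralClosure_eq_adjoin (h : IsRadicalGenerator n y D) (hn : (n : k) ≠ 0)
    (hD0 : 0 ≤ p.ord D) (hD1 : p.ord D ≤ 1) :
    integralClosure p.ring K = Algebra.adjoin p.ring {y} := by
  apply le_antisymm
  · intro t ht
    obtain ⟨f, hf, rfl⟩ := h.exists_polynomial t
    rw [aeval_eq_sum_range' hf]
    refine sum_mem fun i hi => ?_
    have hi' := Finset.mem_range.1 hi
    have hmem : f.coeff i ∈ p.ring := by
      by_cases h0 : f.coeff i = 0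
      · rw [h0]; exact zero_mem _
      · rw [p.mem_ring_iff h0]
        have := h.nonneg_ord_coeff p hn hf ht i h0
        by_contra hneg
        -- A coefficient of negative order would give n ν(c) + i ν(D) ≤ -n + i < 0.
        have h1 : p.ord (f.coeff i) ≤ -1 := by omega
        have h2 : (i : ℤ) * p.ord D ≤ i := by nlinarith
        have h3 : (n : ℤ) * p.ord (f.coeff i) ≤ -n := by nlinarith
        omega
    rw [Algebra.smul_def]
    exact mul_mem (algebraMap_mem (Algebra.adjoin p.ring {y}) (⟨_, hmem⟩ : p.ring))
      (pow_mem (Algebra.self_mem_adjoin_singleton _ _) _)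
  · rw [Algebra.adjoin_le_iff, Set.singleton_subset_iff]
    have := h.isIntegral_monomial p (c := 1) (i := 1) (by simpa [p.ord_one] using hD0)
    rw [map_one, one_mul, pow_one] at this
    exact this

/-- The floor gives the least exponent of π for which the monomial in y^i is integral, so every
integral monomial is an 𝔬-multiple of it. -/
theorem exists_basis (h : IsRadicalGenerator n y D) (hn : (n : k) ≠ 0) {π : F}
    (hπ : p.ord π = 1) :
    ∃ B : Module.Basis (Fin n) p.ring (integralClosure p.ring K), ∀ i : Fin n,
      (B i : K) = algebraMap F K π ^ (-⌊(i : ℚ) * (p.ord D : ℚ) / n⌋) * y ^ (i : ℕ) := by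
  have hfloor : ∀ i : ℕ, ⌊(i : ℚ) * (p.ord D : ℚ) / n⌋ = (i * p.ord D) / n := by
    intro i
    rw [← Rat.floor_intCast_div_natCast]
    push_cast
    rfl
  have hn0 : (0 : ℤ) < n := by have := h.one_lt; omega
  have hπ0 : π ≠ 0 := p.ord_ne_zero_imp (by omega)
  simp_rw [hfloor]
  have hb : ∀ i : ℕ, IsIntegral p.ring
      (algebraMap F K π ^ (-((i * p.ord D) / n : ℤ)) * y ^ (i : ℕ)) := by
    intro i
    rw [← map_zpow₀]
    refine h.isIntegral_monomial p ?_
    rw [p.ord_zpow, hπ]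
    have := Int.mul_ediv_self_le (x := i * p.ord D) hn0.ne'
    linarith
  let b : Fin n → integralClosure p.ring K := fun i => ⟨_, hb i⟩
  have hyli : LinearIndependent F fun i : Fin n => y ^ (i : ℕ) := by
    have := linearIndependent_pow (K := F) y
    rw [h.minpoly_eq, natDegree_X_pow_sub_C] at this
    exact this
  have hli : LinearIndependent p.ring b := by
    have h1 : LinearIndependent F fun i : Fin n =>
        algebraMap F K π ^ (-((i * p.ord D) / n : ℤ)) * y ^ (i : ℕ) := by
      have := hyli.units_smul fun i : Fin n => (Units.mk0 π hπ0) ^ (-((i * p.ord D) / n : ℤ))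
      convert this using 2 with i
      simp [Units.smul_def, Algebra.smul_def]
    have h2 := h1.restrict_scalars' p.ring
    exact LinearIndependent.of_comp (integralClosure p.ring K).val.toLinearMap h2
  refine ⟨Module.Basis.mk hli ?_, fun i => by rw [Module.Basis.mk_apply]⟩
  rintro t -
  obtain ⟨f, hf, hft⟩ := h.exists_polynomial (t : K)
  have hint : IsIntegral p.ring (aeval y f) := by rw [hft]; exact t.2
  have hmem : ∀ i : ℕ, f.coeff i * π ^ ((i * p.ord D) / n : ℤ) ∈ p.ring := by
    intro i
    by_cases h0 : f.coeff i = 0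
    · rw [h0, zero_mul]; exact zero_mem _
    · have hz : π ^ ((i * p.ord D) / n : ℤ) ≠ 0 := zpow_ne_zero _ hπ0
      rw [p.mem_ring_iff (mul_ne_zero h0 hz), p.ord_mul h0 hz, p.ord_zpow, hπ]
      have h1 := h.nonneg_ord_coeff p hn hf hint i h0
      have h2 : -p.ord (f.coeff i) ≤ (i * p.ord D) / n := by
        rw [Int.le_ediv_iff_mul_le hn0]
        linarith
      omega
  have hsum : t = ∑ i : Fin n, (⟨_, hmem i⟩ : p.ring) • b i := by
    apply Subtype.ext
    rw [AddSubmonoidClass.coe_finsetSum, ← hft, aeval_eq_sum_range' hf, Finset.sum_range]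
    refine Finset.sum_congr rfl fun i _ => ?_
    change f.coeff i • y ^ (i : ℕ) = (f.coeff i * π ^ ((i * p.ord D) / n : ℤ)) •
      (algebraMap F K π ^ (-((i * p.ord D) / n : ℤ)) * y ^ (i : ℕ))
    have hπK : algebraMap F K π ≠ 0 := (_root_.map_ne_zero _).2 hπ0
    rw [Algebra.smul_def, Algebra.smul_def, map_mul, map_zpow₀, zpow_neg]
    field_simp
  rw [hsum]
  exact Submodule.sum_mem _ fun i _ => Submodule.smul_mem _ _ (Submodule.subset_span ⟨i, rfl⟩)

end IsRadicalGenerator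

/-! ### Places above `p` and maximal ideals of the integral closure -/

namespace FFPlace.Over

variable {k F K : Type*} [Field k] [Field F] [Algebra k F] [Field K] [Algebra k K] [Algebra F K]
  {p : FFPlace k F}

instance (P : p.Over K) : IsScalarTower p.ring P.place.ring K :=
  .of_algebraMap_eq fun _ => rfl

theorem mem_ring_of_isIntegral (P : p.Over K) {x : K} (hx : IsIntegral p.ring x) :
    x ∈ P.place.ring := by
  obtain ⟨b, rfl⟩ := IsIntegrallyClosed.isIntegral_iff.1 (hx.tower_top (A := P.place.ring))
  exact b.2

/-- The integral closure is contained in the valuation ring of every place above. -/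
def ofIntegralClosure (P : p.Over K) : integralClosure p.ring K →ₐ[p.ring] P.place.ring where
  toFun x := ⟨x, P.mem_ring_of_isIntegral x.2⟩
  map_one' := rfl
  map_mul' _ _ := rfl
  map_zero' := rfl
  map_add' _ _ := rfl
  commutes' _ := rfl

/-- The center of a place on the integral closure. -/
def center (P : p.Over K) : Ideal (integralClosure p.ring K) :=
  (IsLocalRing.maximalIdeal P.place.ring).comap P.ofIntegralClosure

instance (P : p.Over K) : P.center.IsPrime := Ideal.IsPrime.comap _

theorem algebraMap_mem_center (P : p.Over K) {t : p.ring}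
    (ht : t ∈ IsLocalRing.maximalIdeal p.ring) :
    algebraMap p.ring (integralClosure p.ring K) t ∈ P.center := by
  change algebraMap p.ring P.place.ring t ∈ IsLocalRing.maximalIdeal P.place.ring
  exact (map_mem_nonunits_iff (algebraMap p.ring P.place.ring) t).2 ht

theorem isUnit_of_notMem_center (P : p.Over K) {s : integralClosure p.ring K}
    (hs : s ∉ P.center) : IsUnit (P.ofIntegralClosure s) := by
  by_contra h
  exact hs h

/-- If e were 0, all of `F` would have order 0 at P and so lie in the valuation ring of `p`. -/
theorem ramificationIdx_pos (P : p.Over K) : 0 < P.ramificationIdx := by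
  refine Nat.pos_of_ne_zero fun h => p.ring_ne_top ?_
  rw [eq_top_iff]
  intro t _
  by_cases ht : t = 0
  · rw [ht]; exact zero_mem _
  rw [← P.algebraMap_mem_iff, P.place.mem_ring_iff ((_root_.map_ne_zero _).2 ht), P.ord_algebraMap,
    h]
  simp

theorem ext_place {P Q : p.Over K} (h : P.place.ring = Q.place.ring) : P = Q := by
  have h' := ext_ring h
  cases P; cases Q; cases h'; rfl

section Dedekind

variable [FiniteDimensional F K] [Algebra.IsSeparable F K]

instance : IsDedekindDomain (integralClosure p.ring K) :=
  integralClosure.isDedekindDomain p.ring F K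

instance : IsFractionRing (integralClosure p.ring K) K :=
  integralClosure.isFractionRing_of_finite_extension F K

/-- The center of a place, as a point of the height one spectrum. -/
def heightOne (P : p.Over K) :
    IsDedekindDomain.HeightOneSpectrum (integralClosure p.ring K) where
  asIdeal := P.center
  isPrime := inferInstance
  ne_bot := by
    obtain ⟨t, ht⟩ := p.exists_ord_eq_one
    have ht0 : t ≠ 0 := p.ord_ne_zero_imp (by omega)
    have htmem : t ∈ p.ring := (p.mem_ring_iff ht0).2 (by omega)
    have h := P.algebraMap_mem_center (t := ⟨t, htmem⟩)
      ((p.mem_maximalIdeal_iff (t := ⟨t, htmem⟩) ht0).2 (by rw [ht]; norm_num))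
    intro hbot
    rw [hbot, Ideal.mem_bot] at h
    exact (_root_.map_ne_zero (algebraMap F K)).2 ht0 (congrArg Subtype.val h)

/-- The valuation ring of P is the localization of the integral closure at the center, because that
localization is already a valuation ring. -/
theorem exists_mul_eq (P : p.Over K) {x : K} (hx : x ∈ P.place.ring) :
    ∃ a s : integralClosure p.ring K, s ∉ P.center ∧ x * s = a := by
  obtain ⟨a, s, h | h⟩ := P.heightOne.exists_primeCompl_mul_eq_or_mul_eq x
  · exact ⟨a, s, s.2, h⟩
  · refine ⟨s, a, fun ha => s.2 ?_, h⟩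
    have : P.ofIntegralClosure s = ⟨x, hx⟩ * P.ofIntegralClosure a := Subtype.ext h.symm
    change P.ofIntegralClosure s ∈ IsLocalRing.maximalIdeal P.place.ring
    rw [this]
    exact Ideal.mul_mem_left _ _ ha

theorem eq_of_center_eq {P Q : p.Over K} (h : P.center = Q.center) : P = Q := by
  have key : ∀ P Q : p.Over K, P.center = Q.center → P.place.ring ≤ Q.place.ring := by
    intro P Q h x hx
    obtain ⟨a, s, hs, hxs⟩ := P.exists_mul_eq hx
    rw [h] at hs
    obtain ⟨b, hb⟩ := (Q.isUnit_of_notMem_center hs).exists_right_inv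
    have hb' : (s : K) * b = 1 := congrArg Subtype.val hb
    have : x = (Q.ofIntegralClosure a * b : Q.place.ring) := by
      change x = (a : K) * b
      rw [← hxs, mul_assoc, hb', mul_one]
    rw [this]
    exact Subtype.property _
  exact ext_place (le_antisymm (key P Q h) (key Q P h.symm))

variable [IsScalarTower k F K]

/-- The place is given by the q-adic valuation; with `eq_of_center_eq` this identifies places above
`p` with maximal ideals. -/
theorem exists_center_eq (q : Ideal (integralClosure p.ring K)) [hq : q.IsMaximal] :
    ∃ P : p.Over K, P.center = q := by
  have hcomap : q.comap (algebraMap p.ring (integralClosure p.ring K)) =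
      IsLocalRing.maximalIdeal p.ring :=
    IsLocalRing.eq_maximalIdeal (Ideal.isMaximal_comap_of_isIntegral_of_isMaximal q)
  obtain ⟨π, hπ⟩ := p.exists_ord_eq_one
  have hmemq : ∀ t : F, 0 < p.ord t → ∀ ht : IsIntegral p.ring (algebraMap F K t),
      (⟨algebraMap F K t, ht⟩ : integralClosure p.ring K) ∈ q := by
    intro t ht hint
    have ht0 : t ≠ 0 := p.ord_ne_zero_imp (by omega)
    have htmem : t ∈ p.ring := (p.mem_ring_iff ht0).2 (by omega)
    have h := (p.mem_maximalIdeal_iff (t := ⟨t, htmem⟩) ht0).2 ht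
    rw [← hcomap] at h
    exact h
  have hintA : ∀ t : F, t ∈ p.ring → IsIntegral p.ring (algebraMap F K t) := fun t ht =>
    isIntegral_algebraMap (R := p.ring) (A := K) (x := ⟨t, ht⟩)
  have hne : q ≠ ⊥ := by
    have hπ0 : π ≠ 0 := p.ord_ne_zero_imp (by omega)
    have h := hmemq π (by omega) (hintA π ((p.mem_ring_iff hπ0).2 (by omega)))
    intro hbot
    rw [hbot, Ideal.mem_bot] at h
    exact (_root_.map_ne_zero (algebraMap F K)).2 hπ0 (congrArg Subtype.val h)
  let v : IsDedekindDomain.HeightOneSpectrum (integralClosure p.ring K) :=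
    ⟨q, hq.isPrime, hne⟩
  let R : ValuationSubring K := (v.valuation K).valuationSubring
  have hR : IsDiscreteValuationRing R := (v.valuation K).valuationSubring_isDiscreteValuationRing
  have hAR : ∀ t : F, t ∈ p.ring → algebraMap F K t ∈ R := fun t ht =>
    v.valuation_le_one (K := K) ⟨_, hintA t ht⟩
  let Q : FFPlace k K :=
    { ring := R
      algebraMap_mem := fun c => by
        rw [IsScalarTower.algebraMap_apply k F K]
        exact hAR _ (p.algebraMap_mem c)
      isDVR := hR }
  have hover : Q.ring.comap (algebraMap F K) = p.ring := by
    ext t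
    refine ⟨fun ht => ?_, fun ht => hAR t ht⟩
    -- If t is outside the valuation ring of `p`, its inverse has positive order, hence lies in q,
    -- so t has q-adic absolute value greater than 1.
    by_contra hn
    have ht0 : t ≠ 0 := by rintro rfl; exact hn (zero_mem _)
    rw [p.mem_ring_iff ht0, not_le] at hn
    have hinv : 0 < p.ord t⁻¹ := by rw [p.ord_inv]; omega
    have hint := hintA t⁻¹ ((p.mem_ring_iff (inv_ne_zero ht0)).2 hinv.le)
    have h1 := (v.valuation_lt_one_iff_mem (K := K) ⟨_, hint⟩).2 (hmemq _ hinv hint)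
    have h2 : v.valuation K (algebraMap F K t) ≤ 1 := ht
    have h3 : v.valuation K (algebraMap F K t) * v.valuation K (algebraMap F K t⁻¹) = 1 := by
      rw [← map_mul, ← map_mul, mul_inv_cancel₀ ht0, map_one, map_one]
    have h4 : v.valuation K (algebraMap F K t⁻¹) < 1 := h1
    exact absurd h3 (mul_lt_one_of_nonneg_of_lt_one_right h2 zero_le h4).ne
  refine ⟨⟨Q, hover⟩, ?_⟩
  refine (hq.eq_of_le (Ideal.IsPrime.ne_top inferInstance) fun x hx => ?_).symm
  by_contra hxc
  obtain ⟨b, hb⟩ := (isUnit_of_notMem_center _ hxc).exists_right_inv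
  have hb' : (x : K) * b = 1 := congrArg Subtype.val hb
  have h1 : v.valuation K (x : K) < 1 := (v.valuation_lt_one_iff_mem (K := K) x).2 hx
  have h2 : v.valuation K (b : K) ≤ 1 := b.2
  have h3 := congrArg (v.valuation K) hb'
  rw [map_mul, map_one] at h3
  exact absurd h3 (mul_lt_one_of_nonneg_of_lt_one_left zero_le h1 h2).ne

theorem nonempty : Nonempty (p.Over K) := by
  obtain ⟨q, hq⟩ := Ideal.exists_maximal (integralClosure p.ring K)
  exact ⟨(exists_center_eq q).choose⟩

end Dedekind

end FFPlace.Over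

/-! ### The ramification index -/

namespace FFPlace.Over

variable {k F K : Type*} [Field k] [Field F] [Algebra k F] [Field K] [Algebra k K] [Algebra F K]
  {p : FFPlace k F}

theorem ord_eq_zero_of_notMem_center (P : p.Over K) {s : integralClosure p.ring K}
    (hs : s ∉ P.center) : P.place.ord (s : K) = 0 := by
  have hs0 : (s : K) ≠ 0 := by
    intro h
    have : s = 0 := Subtype.ext h
    exact hs (this ▸ zero_mem _)
  have hmem := P.mem_ring_of_isIntegral s.2
  have h1 := (P.place.mem_ring_iff hs0).1 hmem
  have h2 : ¬ 0 < P.place.ord (s : K) := fun h =>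
    hs ((P.place.mem_maximalIdeal_iff (t := ⟨s, hmem⟩) hs0).2 h)
  omega

theorem mem_center_iff (P : p.Over K) {s : integralClosure p.ring K} (hs : (s : K) ≠ 0) :
    s ∈ P.center ↔ 0 < P.place.ord (s : K) :=
  P.place.mem_maximalIdeal_iff (t := P.ofIntegralClosure s) hs

/-- There is a uniformizer of a place in the radical of the ideal generated by a given nonzero
element of the center. -/
theorem exists_ord_eq_one_pow_mem [FiniteDimensional F K] [Algebra.IsSeparable F K]
    (P : p.Over K) {ϖ : integralClosure p.ring K} (hϖ : ϖ ≠ 0) :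
    ∃ (x : integralClosure p.ring K) (N : ℕ), P.place.ord (x : K) = 1 ∧
      x ^ N ∈ Ideal.span {ϖ} := by
  obtain ⟨t, ht⟩ := P.place.exists_ord_eq_one
  have ht0 : t ≠ 0 := P.place.ord_ne_zero_imp (by omega)
  obtain ⟨a, s, hs, hts⟩ := P.exists_mul_eq ((P.place.mem_ring_iff ht0).2 (by omega))
  have hs0 : (s : K) ≠ 0 := by
    intro h
    have : s = 0 := Subtype.ext h
    exact hs (this ▸ zero_mem _)
  have ha : P.place.ord (a : K) = 1 := by
    rw [← hts, P.place.ord_mul ht0 hs0, ht, P.ord_eq_zero_of_notMem_center hs, add_zero]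
  have ha0 : (a : K) ≠ 0 := P.place.ord_ne_zero_imp (by omega)
  have hac : a ∈ P.center := (P.mem_center_iff ha0).2 (by omega)
  have hspan : Ideal.span {ϖ} ≠ ⊥ := by simpa using hϖ
  -- Factor (ϖ) as P^μ I with P not dividing I. A factor c in I outside P keeps the order of a·c
  -- equal to 1, and (a·c)^(μ+1) lies in P^μ I.
  obtain ⟨I, hI, hdvd⟩ := (FiniteMultiplicity.of_prime_left P.heightOne.prime
    hspan).exists_eq_pow_mul_and_not_dvd
  generalize multiplicity P.heightOne.asIdeal (Ideal.span {ϖ}) = μ at hI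
  rw [Ideal.dvd_iff_le, SetLike.not_le_iff_exists] at hdvd
  obtain ⟨c, hcI, hcP⟩ := hdvd
  have hc0 : (c : K) ≠ 0 := by
    intro h
    have : c = 0 := Subtype.ext h
    exact hcP (this ▸ zero_mem _)
  refine ⟨a * c, μ + 1, ?_, ?_⟩
  · rw [MulMemClass.coe_mul, P.place.ord_mul ha0 hc0, ha, P.ord_eq_zero_of_notMem_center hcP,
      add_zero]
  · rw [hI, pow_succ, mul_pow, mul_assoc]
    exact Ideal.mul_mem_mul (Ideal.pow_mem_pow hac _) (I.mul_mem_left _ (I.mul_mem_left _ hcI))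

end FFPlace.Over

namespace IsRadicalGenerator

variable {k F K : Type*} [Field k] [Field F] [Algebra k F] [Field K] [Algebra k K] [Algebra F K]
  {n : ℕ} {y : K} {D : F} {p : FFPlace k F}

theorem ord_generator (h : IsRadicalGenerator n y D) (P : p.Over K) :
    n * P.place.ord y = P.ramificationIdx * p.ord D := by
  rw [← P.ord_algebraMap, ← h.pow_eq, P.place.ord_pow]

/-- With n = d m, ν(D) = d v' and e = m g, a monomial c y^i has P-order g (m ν(c) + i v'). For a
uniformizer in the radical of (ϖ) the bracket is positive for every nonzero monomial, so 1 ≥ g. -/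
theorem ramificationIdx_eq (h : IsRadicalGenerator n y D) (hn : (n : k) ≠ 0) (P : p.Over K) :
    P.ramificationIdx = n / Int.gcd n (p.ord D) := by
  have := h.finiteDimensional
  have := h.isSeparable
  have hw := h.ord_generator P
  have he := P.ramificationIdx_pos
  set e := P.ramificationIdx
  set v := p.ord D
  set d := Int.gcd n v
  have hn0 := h.ne_zero_nat
  have hd0 : 0 < d := Int.gcd_pos_of_ne_zero_left _ (by exact_mod_cast hn0)
  obtain ⟨m, hm⟩ : d ∣ n := by
    have := Int.gcd_dvd_left (n : ℤ) v
    exact_mod_cast this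
  obtain ⟨v', hv'⟩ : (d : ℤ) ∣ v := Int.gcd_dvd_right _ _
  have hd0' : (d : ℤ) ≠ 0 := by exact_mod_cast hd0.ne'
  have hmn : (n : ℤ) = d * m := by exact_mod_cast hm
  have hcop : IsCoprime (m : ℤ) v' := by
    refine ⟨Int.gcdA n v, Int.gcdB n v, ?_⟩
    have hb := Int.gcd_eq_gcd_ab n v
    apply mul_left_cancel₀ hd0'
    have h1 : (d : ℤ) = n * Int.gcdA n v + v * Int.gcdB n v := hb
    linear_combination -h1 - Int.gcdA n v * hmn - Int.gcdB n v * hv'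
  have hm0 : 0 < m := Nat.pos_of_ne_zero (by rintro rfl; simp at hm; exact hn0 hm)
  have hmw : (m : ℤ) * P.place.ord y = e * v' := by
    apply mul_left_cancel₀ hd0'
    rw [← mul_assoc, ← hmn, hw, hv']
    ring
  obtain ⟨g, hg⟩ : m ∣ e := by
    have : (m : ℤ) ∣ e := hcop.dvd_of_dvd_mul_right ⟨_, hmw.symm⟩
    exact_mod_cast this
  have hgoal : n / d = m := by rw [hm, Nat.mul_div_cancel_left _ hd0]
  rw [hgoal]
  obtain ⟨π, hπ⟩ := p.exists_ord_eq_one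
  have hπ0 : π ≠ 0 := p.ord_ne_zero_imp (by omega)
  let ϖ : p.ring := ⟨π, (p.mem_ring_iff hπ0).2 (by omega)⟩
  have hϖ0 : ϖ ≠ 0 := fun h => hπ0 (congrArg Subtype.val h)
  have hϖK : algebraMap p.ring (integralClosure p.ring K) ϖ ≠ 0 := fun h =>
    (_root_.map_ne_zero (algebraMap F K)).2 hπ0 (congrArg Subtype.val h)
  obtain ⟨x, N, hx1, hxN⟩ := P.exists_ord_eq_one_pow_mem hϖK
  obtain ⟨s, hs⟩ := Ideal.mem_span_singleton.1 hxN
  obtain ⟨f, hf, hfx⟩ := h.exists_polynomial (x : K)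
  have hint : IsIntegral p.ring (aeval y f) := by rw [hfx]; exact x.2
  have hfs : aeval y f ^ N = algebraMap p.ring K ϖ * s := by
    rw [hfx]
    exact congrArg Subtype.val hs
  have hle : (g : ℤ) ≤ P.place.ord (x : K) := by
    have hx0 : (x : K) ≠ 0 := P.place.ord_ne_zero_imp (by omega)
    rw [← hfx, aeval_eq_sum_range] at hx0 ⊢
    refine P.place.le_ord_sum _ _ _ (fun i _ => ?_) hx0
    by_cases hi : f.coeff i = 0
    · exact .inl (by rw [hi, zero_smul])
    refine .inr ?_
    obtain ⟨M, hM, hle⟩ := h.exists_le_ord_coeff p hn hf hint ϖ hϖ0 N s.2 hfs i hi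
    have hpos : 0 < (n : ℤ) * p.ord (f.coeff i) + i * v := by
      have h1 : p.ord (ϖ : F) = 1 := hπ
      rw [h1, mul_one] at hle
      exact pos_of_mul_pos_right (lt_of_lt_of_le (by omega) hle) (by positivity)
    have hpos' : 0 < (m : ℤ) * p.ord (f.coeff i) + i * v' := by
      have h2 : (n : ℤ) * p.ord (f.coeff i) + i * v =
          d * ((m : ℤ) * p.ord (f.coeff i) + i * v') := by
        rw [hmn, hv']
        ring
      rw [h2] at hpos
      exact pos_of_mul_pos_right hpos (by positivity)
    rw [Algebra.smul_def, P.place.ord_mul ((_root_.map_ne_zero _).2 hi) (pow_ne_zero _ h.ne_zero),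
      P.ord_algebraMap, P.place.ord_pow]
    have hmpos : (0 : ℤ) < m := by exact_mod_cast hm0
    refine le_of_mul_le_mul_left ?_ hmpos
    have h3 : (m : ℤ) * (e * p.ord (f.coeff i) + i * P.place.ord y) =
        e * (m * p.ord (f.coeff i) + i * v') := by
      linear_combination (i : ℤ) * hmw
    have h4 : (e : ℤ) = m * g := by exact_mod_cast hg
    change (m : ℤ) * g ≤ m * (e * p.ord (f.coeff i) + i * P.place.ord y)
    rw [h3, ← h4]
    have : (0 : ℤ) < e := by exact_mod_cast he
    nlinarith
  rw [hx1] at hle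
  have hg1 : g = 1 := by
    have : g ≠ 0 := by rintro rfl; simp at hg; omega
    omega
  rw [hg, hg1, mul_one]

end IsRadicalGenerator

/-! ### Residue classes and Kummer–Dedekind for a monogenic integral closure -/

theorem Polynomial.Monic.dvd_of_aeval_eq_zero {A F K : Type*} [CommRing A] [Field F] [Field K]
    [Algebra A F] [IsFractionRing A F] [Algebra F K] [Algebra A K] [IsScalarTower A F K] {z : K}
    {f : A[X]} (hf : f.Monic) (hmin : minpoly F z = f.map (algebraMap A F)) {G : A[X]}
    (hG : aeval z G = 0) : f ∣ G := by
  have hdvd := minpoly.dvd F z (p := G.map (algebraMap A F)) (by rw [aeval_map_algebraMap, hG])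
  rwa [hmin, Polynomial.map_dvd_map _ (IsFractionRing.injective A F) hf] at hdvd

namespace FFPlace.Over

variable {k F K : Type*} [Field k] [Field F] [Algebra k F] [Field K] [Algebra k K] [Algebra F K]
  {p : FFPlace k F}

/-- The residue class at a place of an element of the integral closure. -/
noncomputable def residueClass (P : p.Over K) : integralClosure p.ring K →ₐ[p.ring] P.place.residueField :=
  (IsScalarTower.toAlgHom p.ring P.place.ring P.place.residueField).comp P.ofIntegralClosure

theorem residueClass_eq_zero_iff (P : p.Over K) {x : integralClosure p.ring K} :
    P.residueClass x = 0 ↔ x ∈ P.center :=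
  IsLocalRing.residue_eq_zero_iff _

theorem residueClass_aeval (P : p.Over K) (z : integralClosure p.ring K) (G : p.ring[X]) :
    P.residueClass (aeval z G) =
      aeval (P.residueClass z) (G.map (IsLocalRing.residue p.ring)) := by
  rw [← aeval_algHom_apply]
  exact (aeval_map_algebraMap p.residueField (P.residueClass z) G).symm

theorem isIntegral_residueClass (P : p.Over K) (z : integralClosure p.ring K) :
    IsIntegral p.residueField (P.residueClass z) := by
  have hz : IsIntegral p.ring z := Algebra.IsIntegral.isIntegral z
  exact (hz.map P.residueClass).tower_top

omit [Algebra k K] in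
theorem exists_aeval_eq {z : integralClosure p.ring K}
    (hz : integralClosure p.ring K = Algebra.adjoin p.ring {(z : K)})
    (x : integralClosure p.ring K) : ∃ G : p.ring[X], aeval z G = x := by
  have hx := hz.le x.2
  rw [Algebra.adjoin_singleton_eq_range_aeval] at hx
  obtain ⟨G, hG⟩ := hx
  refine ⟨G, Subtype.ext ?_⟩
  rw [← hG]
  exact (aeval_algHom_apply (integralClosure p.ring K).val z G).symm

/-- Every integral element is G(z), and it lies in the center exactly when the minimal polynomial of
the residue of z divides the reduction of G. So that polynomial determines the center. -/
theorem eq_of_minpoly_eq [FiniteDimensional F K] [Algebra.IsSeparable F K]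
    {z : integralClosure p.ring K}
    (hz : integralClosure p.ring K = Algebra.adjoin p.ring {(z : K)}) {P Q : p.Over K}
    (h : minpoly p.residueField (P.residueClass z) =
      minpoly p.residueField (Q.residueClass z)) : P = Q := by
  have key : ∀ (P : p.Over K) (G : p.ring[X]), aeval z G ∈ P.center ↔
      minpoly p.residueField (P.residueClass z) ∣ G.map (IsLocalRing.residue p.ring) := by
    intro P G
    rw [← residueClass_eq_zero_iff, residueClass_aeval, minpoly.dvd_iff]
  refine eq_of_center_eq (Ideal.ext fun x => ?_)
  obtain ⟨G, rfl⟩ := exists_aeval_eq hz x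
  rw [key, key, h]

theorem inertiaDeg_eq_natDegree [FiniteDimensional F K] [Algebra.IsSeparable F K]
    {z : integralClosure p.ring K}
    (hz : integralClosure p.ring K = Algebra.adjoin p.ring {(z : K)}) (P : p.Over K) :
    P.inertiaDeg = (minpoly p.residueField (P.residueClass z)).natDegree := by
  have hmem : ∀ x : integralClosure p.ring K, P.residueClass x ∈
      IntermediateField.adjoin p.residueField {P.residueClass z} := by
    intro x
    obtain ⟨G, rfl⟩ := exists_aeval_eq hz x
    rw [residueClass_aeval]
    exact IntermediateField.algebra_adjoin_le_adjoin _ _ (aeval_mem_adjoin_singleton _ _)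
  -- An element of the valuation ring is a/s with s outside the center, so its residue is a quotient
  -- of polynomials in the residue of z.
  have htop : IntermediateField.adjoin p.residueField {P.residueClass z} = ⊤ := by
    rw [eq_top_iff]
    intro x _
    obtain ⟨w, rfl⟩ := IsLocalRing.residue_surjective x
    obtain ⟨a, s, hs, hws⟩ := P.exists_mul_eq w.2
    have h1 : w * P.ofIntegralClosure s = P.ofIntegralClosure a := Subtype.ext hws
    have h2 : IsLocalRing.residue P.place.ring w * P.residueClass s = P.residueClass a := by
      have := congrArg (IsLocalRing.residue P.place.ring) h1
      rw [map_mul] at this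
      exact this
    have h3 : P.residueClass s ≠ 0 := fun h => hs (P.residueClass_eq_zero_iff.1 h)
    rw [eq_div_of_mul_eq h3 h2]
    exact div_mem (hmem a) (hmem s)
  have hrank := IntermediateField.adjoin.finrank (P.isIntegral_residueClass z)
  rw [htop, IntermediateField.finrank_top'] at hrank
  exact hrank

theorem exists_isRoot_residueClass [FiniteDimensional F K] [Algebra.IsSeparable F K]
    [IsScalarTower k F K] {z : integralClosure p.ring K}
    (hz : integralClosure p.ring K = Algebra.adjoin p.ring {(z : K)}) {f : p.ring[X]}
    (hf : f.Monic) (hmin : minpoly F (z : K) = f.map (algebraMap p.ring F))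
    {g : p.residueField[X]} (hg : Irreducible g)
    (hgf : g ∣ f.map (IsLocalRing.residue p.ring)) :
    ∃ P : p.Over K, aeval (P.residueClass z) g = 0 := by
  obtain ⟨G, rfl⟩ := Polynomial.map_surjective _ IsLocalRing.residue_surjective g
  obtain ⟨ϖ, hϖ⟩ := IsDiscreteValuationRing.exists_irreducible p.ring
  have hϖ0 : IsLocalRing.residue p.ring ϖ = 0 :=
    (IsLocalRing.residue_eq_zero_iff _).2 hϖ.not_isUnit
  let J : Ideal (integralClosure p.ring K) :=
    Ideal.span {algebraMap p.ring _ ϖ, aeval z G}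
  -- Otherwise Aϖ + BG - 1 vanishes at z, hence is divisible by f; reducing, g divides Bg - 1 and is
  -- a unit. A maximal ideal containing J then gives the place.
  have hJ : J ≠ ⊤ := by
    intro htop
    obtain ⟨a, b, hab⟩ := Ideal.mem_span_pair.1 ((Ideal.eq_top_iff_one J).1 htop)
    obtain ⟨A, rfl⟩ := exists_aeval_eq hz a
    obtain ⟨B, rfl⟩ := exists_aeval_eq hz b
    have h0 : aeval z (A * C ϖ + B * G - 1) = 0 := by
      rw [map_sub, map_add, map_mul, map_mul, aeval_C, hab, map_one, sub_self]
    have h0K : aeval (z : K) (A * C ϖ + B * G - 1) = 0 := by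
      have := aeval_algHom_apply (integralClosure p.ring K).val z (A * C ϖ + B * G - 1)
      rw [h0, map_zero] at this
      exact this
    have h1 := hgf.trans (Polynomial.map_dvd (IsLocalRing.residue p.ring)
      (hf.dvd_of_aeval_eq_zero hmin h0K))
    simp only [Polynomial.map_sub, Polynomial.map_add, Polynomial.map_mul, map_C, hϖ0, map_zero,
      mul_zero, zero_add, Polynomial.map_one] at h1
    exact hg.not_isUnit (isUnit_of_dvd_one ((dvd_sub_right (dvd_mul_left _ _)).1 h1))
  obtain ⟨q, hq, hJq⟩ := Ideal.exists_le_maximal J hJ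
  obtain ⟨P, hP⟩ := exists_center_eq (k := k) q
  refine ⟨P, ?_⟩
  rw [← residueClass_aeval, residueClass_eq_zero_iff, hP]
  exact hJq (Ideal.subset_span (by simp))

theorem degree_eq [IsScalarTower k F K] (P : p.Over K) :
    P.place.degree = p.degree * P.inertiaDeg := by
  have : IsScalarTower k p.residueField P.place.residueField := by
    refine .of_algebraMap_eq fun c => ?_
    have h1 : algebraMap k P.place.ring c =
        algebraMap p.ring P.place.ring (algebraMap k p.ring c) :=
      Subtype.ext (IsScalarTower.algebraMap_apply k F K c)
    change IsLocalRing.residue P.place.ring (algebraMap k P.place.ring c) = _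
    rw [h1]
    rfl
  exact (Module.finrank_mul_finrank k p.residueField P.place.residueField).symm

end FFPlace.Over

/-! ### Radicands of order 1 and of order 0 -/

namespace IsRadicalGenerator

variable {k F K : Type*} [Field k] [Field F] [Algebra k F] [Field K] [Algebra k K] [Algebra F K]
  [IsScalarTower k F K] {n : ℕ} {z : K} {r : F} {p : FFPlace k F}

theorem totally_ramified (h : IsRadicalGenerator n z r) (hn : (n : k) ≠ 0) (hr : p.ord r = 1) :
    integralClosure p.ring K = Algebra.adjoin p.ring {z} ∧
      (∃! _P : p.Over K, True) ∧
      ∀ P : p.Over K, P.ramificationIdx = n ∧ P.inertiaDeg = 1 ∧ P.place.ord z = 1 := by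
  have := h.finiteDimensional
  have := h.isSeparable
  have hn0 := h.ne_zero_nat
  have hC := h.integralClosure_eq_adjoin p hn (by omega) hr.le
  have he : ∀ P : p.Over K, P.ramificationIdx = n := fun P => by
    rw [h.ramificationIdx_eq hn P, hr, Int.gcd_one, Nat.div_one]
  have hz : ∀ P : p.Over K, P.place.ord z = 1 := fun P => by
    have h1 := h.ord_generator P
    rw [he, hr] at h1
    exact mul_left_cancel₀ (by exact_mod_cast hn0) h1
  let z' : integralClosure p.ring K :=
    ⟨z, by rw [hC]; exact Algebra.self_mem_adjoin_singleton _ _⟩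
  -- The residue of z is 0 at every place above, with minimal polynomial X; this gives both
  -- uniqueness of the place and inertia degree 1.
  have hres : ∀ P : p.Over K, P.residueClass z' = 0 := fun P => by
    rw [P.residueClass_eq_zero_iff, P.mem_center_iff (s := z') h.ne_zero]
    change 0 < P.place.ord z
    rw [hz]
    norm_num
  refine ⟨hC, ?_, fun P => ⟨he P, ?_, hz P⟩⟩
  · obtain ⟨P⟩ := FFPlace.Over.nonempty (p := p) (K := K)
    refine ⟨P, trivial, fun Q _ => FFPlace.Over.eq_of_minpoly_eq (z := z') hC ?_⟩
    rw [hres, hres, minpoly.zero, minpoly.zero]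
  · rw [P.inertiaDeg_eq_natDegree (z := z') hC, hres, minpoly.zero, natDegree_X]

theorem unramified (h : IsRadicalGenerator n z r) (hn : (n : k) ≠ 0) (hr : p.ord r = 0) :
    integralClosure p.ring K = Algebra.adjoin p.ring {z} ∧
      (∀ P : p.Over K, P.ramificationIdx = 1) ∧
      (∃ (u : p.ring) (α : p.residueField), (u : F) = r ∧
        α = IsLocalRing.residue p.ring u ∧ α ≠ 0 ∧
        ∃ g : p.Over K ≃
            {f : p.residueField[X] // f.Monic ∧ Irreducible f ∧ f ∣ X ^ n - C α},
          ∀ P : p.Over K,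
            P.inertiaDeg = (g P).1.natDegree ∧
            P.place.degree = p.degree * (g P).1.natDegree ∧
            ∃ w : P.place.ring, (w : K) = z ∧
              aeval (IsLocalRing.residue P.place.ring w) (g P).1 = 0) ∧
      ∀ P : p.Over K, P.place.ord z = 0 := by
  have := h.finiteDimensional
  have := h.isSeparable
  have hn0 := h.ne_zero_nat
  have hC := h.integralClosure_eq_adjoin p hn hr.ge (by omega)
  let z' : integralClosure p.ring K :=
    ⟨z, by rw [hC]; exact Algebra.self_mem_adjoin_singleton _ _⟩
  let u : p.ring := ⟨r, (p.mem_ring_iff h.radicand_ne_zero).2 hr.ge⟩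
  have hzu : z' ^ n = algebraMap p.ring _ u := Subtype.ext h.pow_eq
  let g : p.Over K → {f : p.residueField[X] // f.Monic ∧ Irreducible f ∧
      f ∣ X ^ n - C (IsLocalRing.residue p.ring u)} := fun P =>
    ⟨minpoly p.residueField (P.residueClass z'), minpoly.monic (P.isIntegral_residueClass z'),
      minpoly.irreducible (P.isIntegral_residueClass z'), minpoly.dvd _ _ (by
        have h1 := P.residueClass_aeval z' (X ^ n - C u)
        rw [map_sub, map_pow, aeval_X, aeval_C, hzu, sub_self, map_zero, Polynomial.map_sub,
          Polynomial.map_pow, map_X, map_C] at h1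
        exact h1.symm)⟩
  have hg : Function.Bijective g := by
    refine ⟨fun P Q hPQ => FFPlace.Over.eq_of_minpoly_eq (z := z') hC (congrArg Subtype.val hPQ),
      ?_⟩
    rintro ⟨f, hfm, hfi, hfd⟩
    obtain ⟨P, hP⟩ := FFPlace.Over.exists_isRoot_residueClass (z := z') (f := X ^ n - C u) hC
      (monic_X_pow_sub_C u hn0) (by
        rw [Polynomial.map_sub, Polynomial.map_pow, map_X, map_C]
        exact h.minpoly_eq) hfi (by
        rw [Polynomial.map_sub, Polynomial.map_pow, map_X, map_C]
        exact hfd)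
    exact ⟨P, Subtype.ext (minpoly.eq_of_irreducible_of_monic hfi hP hfm).symm⟩
  refine ⟨hC, fun P => ?_, ⟨u, _, rfl, rfl, ?_, Equiv.ofBijective g hg, fun P => ?_⟩, fun P => ?_⟩
  · rw [h.ramificationIdx_eq hn P, hr, Int.gcd_zero_right, Int.natAbs_natCast,
      Nat.div_self (Nat.pos_of_ne_zero hn0)]
  · intro h0
    have h1 := (p.mem_maximalIdeal_iff (t := u) h.radicand_ne_zero).1
      ((IsLocalRing.residue_eq_zero_iff _).1 h0)
    change 0 < p.ord r at h1
    omega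
  · refine ⟨P.inertiaDeg_eq_natDegree (z := z') hC, ?_, P.ofIntegralClosure z', rfl,
      minpoly.aeval _ _⟩
    rw [P.degree_eq, P.inertiaDeg_eq_natDegree (z := z') hC]
    rfl
  · have h1 := h.ord_generator P
    rw [hr, mul_zero] at h1
    exact (mul_eq_zero.1 h1).resolve_left (by exact_mod_cast hn0)

end IsRadicalGenerator

/-! ### Change of radical generator and the existence criterion -/

namespace IsRadicalGenerator

/-- `IsRadicalGenerator` records the degree of `K` instead of irreducibility of the radical
polynomial, so only generation has to be checked for a new generator. -/
theorem of_mem_adjoin {F K : Type*} [Field F] [Field K] [Algebra F K] {n : ℕ} {y z : K} {D r : F}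
    (h : IsRadicalGenerator n y D) (hz : z ^ n = algebraMap F K r)
    (hy : y ∈ IntermediateField.adjoin F {z}) : IsRadicalGenerator n z r where
  one_lt := h.one_lt
  cast_ne_zero := h.cast_ne_zero
  finiteDimensional := h.finiteDimensional
  finrank_eq := h.finrank_eq
  pow_eq := hz
  adjoin_eq_top := by
    rw [eq_top_iff, ← h.adjoin_eq_top, IntermediateField.adjoin_simple_le_iff]
    exact hy

variable {k F K : Type*} [Field k] [Field F] [Algebra k F] [Field K] [Algebra F K]
  {n : ℕ} {y z : K} {D r : F} {p : FFPlace k F}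

theorem of_integralClosure_eq (h : IsRadicalGenerator n y D) (hz : z ^ n = algebraMap F K r)
    (hC : integralClosure p.ring K = Algebra.adjoin p.ring {z}) : IsRadicalGenerator n z r := by
  refine h.of_mem_adjoin hz ?_
  obtain ⟨π, hπ⟩ := p.exists_ord_eq_one
  have hπ0 : algebraMap F K π ≠ 0 :=
    (_root_.map_ne_zero _).2 (p.ord_ne_zero_imp (by omega : p.ord π ≠ 0))
  -- The factor π^|ν(D)| clears the denominator of y: n |ν(D)| + ν(D) ≥ 0.
  have hint : IsIntegral p.ring (algebraMap F K (π ^ |p.ord D|) * y ^ 1) := by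
    refine h.isIntegral_monomial p ?_
    rw [p.ord_zpow, hπ, mul_one, Nat.cast_one, one_mul]
    have h1 : (1 : ℤ) ≤ n := by have := h.one_lt; omega
    have h2 := neg_abs_le (p.ord D)
    have h3 := abs_nonneg (p.ord D)
    nlinarith
  have hmem : algebraMap F K (π ^ |p.ord D|) * y ^ 1 ∈ IntermediateField.adjoin F {z} := by
    have h1 := hC.le hint
    rw [Algebra.adjoin_singleton_eq_range_aeval] at h1
    obtain ⟨G, hG⟩ := h1
    rw [← hG]
    change aeval z G ∈ _
    rw [← aeval_map_algebraMap F]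
    exact IntermediateField.algebra_adjoin_le_adjoin _ _ (aeval_mem_adjoin_singleton _ _)
  have hne : algebraMap F K (π ^ |p.ord D|) ≠ 0 := by
    rw [map_zpow₀]
    exact zpow_ne_zero _ hπ0
  have h2 := mul_mem (inv_mem (IntermediateField.algebraMap_mem
    (IntermediateField.adjoin F {z}) (π ^ |p.ord D|))) hmem
  rwa [inv_mul_cancel_left₀ hne, pow_one] at h2

/-- If the powers of a radical generator span the integral closure, then its radicand is a unit
or a uniformizer. -/
theorem ord_radicand_of_integralClosure_eq (h : IsRadicalGenerator n z r)
    (hC : integralClosure p.ring K = Algebra.adjoin p.ring {z}) :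
    p.ord r = 0 ∨ p.ord r = 1 := by
  have hn0 := h.ne_zero_nat
  have hr0 := h.radicand_ne_zero
  have hz : IsIntegral p.ring z := hC.ge (Algebra.self_mem_adjoin_singleton _ _)
  have hr : IsIntegral p.ring r := by
    rw [← isIntegral_algebraMap_iff (algebraMap F K).injective, ← h.pow_eq]
    exact hz.pow n
  obtain ⟨u, hu⟩ := IsIntegrallyClosed.isIntegral_iff.1 hr
  have hge : 0 ≤ p.ord r := (p.mem_ring_iff hr0).1 (hu ▸ u.2)
  by_contra hcon
  have h2 : 2 ≤ p.ord r := by omega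
  have hu0 : IsLocalRing.residue p.ring u = 0 := by
    have hu' : (u : F) = r := hu
    rw [IsLocalRing.residue_eq_zero_iff, p.mem_maximalIdeal_iff (hu'.trans_ne hr0), hu']
    omega
  obtain ⟨π, hπ⟩ := p.exists_ord_eq_one
  have hπ0 : π ≠ 0 := p.ord_ne_zero_imp (by omega)
  let ϖ : p.ring := ⟨π, (p.mem_ring_iff hπ0).2 (by omega)⟩
  have hϖ : IsLocalRing.residue p.ring ϖ = 0 := by
    rw [IsLocalRing.residue_eq_zero_iff, p.mem_maximalIdeal_iff (t := ϖ) hπ0]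
    change 0 < p.ord π
    omega
  -- Its n-th power has order at least -n + 2(n - 1) = n - 2 ≥ 0. Written as G(z), it makes X^n - u
  -- divide X^(n-1) - ϖG; modulo the maximal ideal, X^n would divide X^(n-1).
  have hint : IsIntegral p.ring (algebraMap F K π⁻¹ * z ^ (n - 1)) := by
    refine h.isIntegral_monomial p ?_
    rw [p.ord_inv, hπ, Nat.cast_sub h.one_lt.le]
    have h1 : (2 : ℤ) ≤ n := by have := h.one_lt; omega
    push_cast
    nlinarith
  have h1 := hC.le hint
  rw [Algebra.adjoin_singleton_eq_range_aeval] at h1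
  obtain ⟨G, hG⟩ := h1
  replace hG : aeval z G = algebraMap F K π⁻¹ * z ^ (n - 1) := hG
  have hzero : aeval z (X ^ (n - 1) - C ϖ * G) = 0 := by
    have hπK : algebraMap F K π ≠ 0 := (_root_.map_ne_zero _).2 hπ0
    rw [map_sub, map_mul, map_pow, aeval_X, aeval_C, hG,
      show algebraMap p.ring K ϖ = algebraMap F K π from rfl, map_inv₀,
      mul_inv_cancel_left₀ hπK, sub_self]
  have hdvd := Polynomial.map_dvd (IsLocalRing.residue p.ring)
    ((monic_X_pow_sub_C u hn0).dvd_of_aeval_eq_zero (F := F) (by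
      rw [Polynomial.map_sub, Polynomial.map_pow, map_X, map_C, hu]
      exact h.minpoly_eq) hzero)
  simp only [Polynomial.map_sub, Polynomial.map_pow, Polynomial.map_mul, map_X, map_C, hu0, hϖ,
    map_zero, zero_mul, sub_zero] at hdvd
  have := (pow_dvd_pow_iff X_ne_zero not_isUnit_X).1 hdvd
  omega

theorem zpow_mul_uniformizer (h : IsRadicalGenerator n y D) {π : F} (hπ : p.ord π = 1) {a b : ℤ}
    (hab : a * p.ord D + b * n = 1) :
    IsRadicalGenerator n (y ^ a * algebraMap F K π ^ b) (D ^ a * π ^ (n * b)) ∧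
      p.ord (D ^ a * π ^ (n * b)) = 1 := by
  have hπ0 : π ≠ 0 := p.ord_ne_zero_imp (by omega)
  have hπK : algebraMap F K π ≠ 0 := (_root_.map_ne_zero _).2 hπ0
  have hy0 := h.ne_zero
  constructor
  · refine h.of_mem_adjoin ?_ ?_
    · rw [mul_pow, map_mul, map_zpow₀, map_zpow₀, ← h.pow_eq, ← zpow_natCast, ← zpow_natCast,
        ← zpow_natCast, ← zpow_mul, ← zpow_mul, ← zpow_mul, mul_comm a, mul_comm b]
    · set z := y ^ a * algebraMap F K π ^ b
      have hya : y ^ a ∈ IntermediateField.adjoin F {z} := by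
        have h1 : y ^ a = z * algebraMap F K (π ^ (-b)) := by
          rw [map_zpow₀, zpow_neg, mul_inv_cancel_right₀ (zpow_ne_zero _ hπK)]
        rw [h1]
        exact mul_mem (IntermediateField.mem_adjoin_simple_self F z)
          (IntermediateField.algebraMap_mem _ _)
      -- The Bézout relation recovers y as y^(aν(D) + bn), with y^n = D.
      have h2 : y = (y ^ a) ^ p.ord D * (algebraMap F K D) ^ b := by
        rw [← h.pow_eq, ← zpow_natCast, ← zpow_mul, ← zpow_mul, ← zpow_add₀ hy0, mul_comm (n : ℤ),
          hab, zpow_one]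
      rw [h2]
      exact mul_mem (zpow_mem hya _) (zpow_mem (IntermediateField.algebraMap_mem _ _) _)
  · rw [p.ord_mul (zpow_ne_zero _ h.radicand_ne_zero) (zpow_ne_zero _ hπ0), p.ord_zpow, p.ord_zpow,
      hπ]
    linarith

theorem mul_uniformizer (h : IsRadicalGenerator n y D) {π : F} (hπ : p.ord π = 1) {b : ℤ}
    (hb : n * b = -p.ord D) :
    IsRadicalGenerator n (y * algebraMap F K π ^ b) (D * π ^ (b * n)) ∧
      p.ord (D * π ^ (b * n)) = 0 := by
  have hπ0 : π ≠ 0 := p.ord_ne_zero_imp (by omega)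
  have hπK : algebraMap F K π ≠ 0 := (_root_.map_ne_zero _).2 hπ0
  constructor
  · refine h.of_mem_adjoin ?_ ?_
    · rw [mul_pow, map_mul, map_zpow₀, ← h.pow_eq, zpow_mul, zpow_natCast]
    · set z := y * algebraMap F K π ^ b
      have h1 : y = z * algebraMap F K (π ^ (-b)) := by
        rw [map_zpow₀, zpow_neg, mul_inv_cancel_right₀ (zpow_ne_zero _ hπK)]
      rw [h1]
      exact mul_mem (IntermediateField.mem_adjoin_simple_self F z)
        (IntermediateField.algebraMap_mem _ _)
  · rw [p.ord_mul h.radicand_ne_zero (zpow_ne_zero _ hπ0), p.ord_zpow, hπ]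
    linarith

theorem exists_radical_generator_iff [Algebra k K] [IsScalarTower k F K]
    (h : IsRadicalGenerator n y D) (hn : (n : k) ≠ 0) :
    (∃ z : K, integralClosure p.ring K = Algebra.adjoin p.ring {z} ∧
      ∃ r : F, z ^ n = algebraMap F K r) ↔
    Int.gcd n (p.ord D) = 1 ∨ Int.gcd n (p.ord D) = n := by
  constructor
  · rintro ⟨z, hC, r, hzr⟩
    have hz := h.of_integralClosure_eq hzr hC
    have := h.finiteDimensional
    have := h.isSeparable
    obtain ⟨P⟩ := FFPlace.Over.nonempty (p := p) (K := K)
    have he := (h.ramificationIdx_eq hn P).symm.trans (hz.ramificationIdx_eq hn P)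
    have hdvd : ∀ v : ℤ, Int.gcd n v ∣ n := fun v => by
      exact_mod_cast Int.gcd_dvd_left (n : ℤ) v
    -- Both generators compute the same ramification index, and n/(n/d) = d.
    have hd : Int.gcd n (p.ord D) = Int.gcd n (p.ord r) := by
      rw [← Nat.div_div_self (hdvd (p.ord D)) h.ne_zero_nat, he,
        Nat.div_div_self (hdvd (p.ord r)) h.ne_zero_nat]
    rw [hd]
    rcases hz.ord_radicand_of_integralClosure_eq hC with h0 | h1
    · right
      rw [h0, Int.gcd_zero_right, Int.natAbs_natCast]
    · left
      rw [h1, Int.gcd_one]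
  · obtain ⟨π, hπ⟩ := p.exists_ord_eq_one
    rintro (h1 | hn')
    · have hb := Int.gcd_eq_gcd_ab n (p.ord D)
      rw [h1] at hb
      obtain ⟨hz, hord⟩ := h.zpow_mul_uniformizer hπ (a := Int.gcdB n (p.ord D))
        (b := Int.gcdA n (p.ord D)) (by push_cast at hb; linarith)
      exact ⟨_, (hz.totally_ramified hn hord).1, _, hz.pow_eq⟩
    · obtain ⟨c, hc⟩ : (n : ℤ) ∣ p.ord D := by
        have := Int.gcd_dvd_right (n : ℤ) (p.ord D)
        rwa [hn'] at this
      obtain ⟨hz, hord⟩ := h.mul_uniformizer hπ (b := -c) (by rw [hc]; ring)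
      exact ⟨_, (hz.unramified hn hord).1, _, hz.pow_eq⟩

end IsRadicalGenerator

/-! ### Assembly over the rational function field -/

open Polynomial in
theorem mainTheorem3 {k : Type*} [Field k] {K : Type*} [Field K] [Algebra k K]
    [Algebra (RatFunc k) K] [IsScalarTower k (RatFunc k) K]
    (n : ℕ) (hn : 1 < n) (hnk : (n : k) ≠ 0)
    (D : RatFunc k) (hirr : Irreducible (X ^ n - C D : (RatFunc k)[X]))
    (y : K) (hy : y ^ n = algebraMap (RatFunc k) K D)
    (hK : IntermediateField.adjoin (RatFunc k) {y} = ⊤)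
    (p : FFPlace k (RatFunc k)) (d : ℕ) (hd : d = Int.gcd n (p.ord D)) :
    -- existence of a radical generator of the integral closure
    ((∃ z : K, integralClosure p.ring K = Algebra.adjoin p.ring {z} ∧
        ∃ r : RatFunc k, z ^ n = algebraMap (RatFunc k) K r) ↔ d = 1 ∨ d = n) ∧
    ∀ π : RatFunc k, p.ord π = 1 →
      -- the case `d = 1`
      (d = 1 → ∀ a b : ℤ, a * p.ord D + b * n = 1 →
        ∀ z : K, z = y ^ a * algebraMap (RatFunc k) K π ^ b →
          integralClosure p.ring K = Algebra.adjoin p.ring {z} ∧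
          minpoly (RatFunc k) z = X ^ n - C (D ^ a * π ^ (n * b)) ∧
          (∃! _P : p.Over K, True) ∧
          ∀ P : p.Over K, P.ramificationIdx = n ∧ P.inertiaDeg = 1 ∧ P.place.ord z = 1) ∧
      -- the case `d = n`
      (d = n → ∀ b : ℤ, n * b = -p.ord D →
        ∀ z : K, z = y * algebraMap (RatFunc k) K π ^ b →
          integralClosure p.ring K = Algebra.adjoin p.ring {z} ∧
          minpoly (RatFunc k) z = X ^ n - C (D * π ^ (-p.ord D)) ∧
          (∀ P : p.Over K, P.ramificationIdx = 1) ∧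
          (∃ (u : p.ring) (α : p.residueField), (u : RatFunc k) = D * π ^ (b * n) ∧
            α = IsLocalRing.residue p.ring u ∧ α ≠ 0 ∧
            ∃ g : p.Over K ≃
                {f : p.residueField[X] // f.Monic ∧ Irreducible f ∧ f ∣ X ^ n - C α},
              ∀ P : p.Over K,
                P.inertiaDeg = (g P).1.natDegree ∧
                P.place.degree = p.degree * (g P).1.natDegree ∧
                ∃ w : P.place.ring, (w : K) = z ∧
                  aeval (IsLocalRing.residue P.place.ring w) (g P).1 = 0) ∧
          ∀ P : p.Over K, P.place.ord z = 0) ∧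
      -- the case `1 < d < n`
      (1 < d → d < n → ∀ P : p.Over K, P.ramificationIdx = n / d) ∧
      -- the local integral basis
      ∃ B : Module.Basis (Fin n) p.ring (integralClosure p.ring K), ∀ i : Fin n,
        (B i : K) =
          algebraMap (RatFunc k) K π ^ (-⌊(i : ℚ) * (p.ord D : ℚ) / n⌋) * y ^ (i : ℕ) := by
  subst hd
  obtain ⟨hfin, hrank⟩ := finrank_eq_of_irreducible_X_pow_sub_C (by omega) hirr hy hK
  have h : IsRadicalGenerator n y D :=
    { one_lt := hn
      cast_ne_zero := by
        rw [← map_natCast (algebraMap k (RatFunc k))]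
        exact (_root_.map_ne_zero _).2 hnk
      finiteDimensional := hfin
      finrank_eq := hrank
      pow_eq := hy
      adjoin_eq_top := hK }
  refine ⟨h.exists_radical_generator_iff hnk, fun π hπ => ⟨?_, ?_, ?_, h.exists_basis p hnk hπ⟩⟩
  · rintro - a b hab z rfl
    obtain ⟨hz, hord⟩ := h.zpow_mul_uniformizer hπ hab
    obtain ⟨h1, h2, h3⟩ := hz.totally_ramified hnk hord
    exact ⟨h1, hz.minpoly_eq, h2, h3⟩
  · rintro - b hb z rfl
    obtain ⟨hz, hord⟩ := h.mul_uniformizer hπ hb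
    obtain ⟨h1, h2, h3, h4⟩ := hz.unramified hnk hord
    refine ⟨h1, ?_, h2, h3, h4⟩
    rw [hz.minpoly_eq, mul_comm b, hb]
  · exact fun _ _ P => h.ramificationIdx_eq hnk P
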